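/- For $n\ge 0$ let $Q_n$ be the $n$-cube: the graph whose vertices are the subsets of $[n]=\{1,\dots,n\}$, with an edge between $X$ and $Y$ if and only if $X\oplus Y=\{i\}$ for some $i\in[n]$, where $\oplus$ is symmetric difference; $i$ is the *direction* of the edge. The *signature* of a spanning tree $T$ of $Q_n$ is $\mathrm{sig}(T)=(a_1,\dots,a_n)$, where $a_i$ is the number of edges of $T$ in direction $i$; an $n$-tuple is a *signature of $Q_n$* if it is the signature of some spanning tree of $Q_n$. Let $\sigma_i$ be the automorphism $X\mapsto X\oplus\{i\}$ of $Q_n$. If $e$ is an edge of a spanning tree $T$ in a direction $j\neq i$, $\sigma_i(e)$ is not an edge of $T$, and $T'=T-e+\sigma_i(e)$ is a spanning tree of $Q_n$, then $T'$ is said to be obtained from $T$ by an *edge slide*. For a signature $\mathcal S$ of $Q_n$, the *edge slide graph* $\mathcal E(\mathcal S)$ is the graph whose vertices are the spanning trees of $Q_n$ with signature $\mathcal S$, two of them being adjacent if and only if they are related by an edge slide. A tuple $(a_i)_{i\in I}$ of nonnegative integers with finite index set $I$ is *reducible* if there is a set $R$ with $\emptyset\neq R\subsetneq I$ and $\sum_{i\in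 R}a_i=2^{|R|}-1$; otherwise it is *irreducible*. Let $\mathcal S=(a_1,\dots,a_n)$ be a signature of $Q_n$, $n\ge1$. For $1\le k\le n$ the *excess* of $\mathcal S$ at $k$ is $$\min_{K\subseteq[n],\ |K|=k}\Bigl(\sum_{i\in K}a_i\Bigr)-(2^k-1).$$ Let $s$ be the least index with $1\le s\le n$ such that the excess of $\mathcal S$ at $k$ is $0$ for all $s\le k\le n$. The *unsaturated part* of $\mathcal S$ is the restriction of $\mathcal S$ to the indices that occupy the first $s$ places when $\mathcal S$ is sorted into nondecreasing order. A reducible signature $\mathcal S$ is *strictly reducible* if its unsaturated part is reducible (that is, not irreducible). **Theorem.** Let $\mathcal S=(a_1,\dots,a_n)$ be a strictly reducible signature of $Q_n$. Then the edge slide graph $\mathcal E(\mathcal S)$ is disconnected. -/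

import Mathlib

open scoped symmDiff

namespace CubeTree

section Cube

variable {ι : Type*} [DecidableEq ι]

/-- The cube on the set of directions `ι`: its vertices are the finite subsets of `ι`, and `X`, `Y`
are adjacent if and only if they differ by adding or removing exactly one element.
The `n`-cube is `cube (Fin n)`. -/
def cube (ι : Type*) [DecidableEq ι] : SimpleGraph (Finset ι) where
  Adj X Y := ∃ i : ι, X ∆ Y = {i}
  symm := ⟨fun X Y ⟨i, hi⟩ => ⟨i, by rw [symmDiff_comm]; exact hi⟩⟩
  loopless := ⟨fun X ⟨i, hi⟩ => by
    rw [symmDiff_self] at hi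
    exact (Finset.singleton_ne_empty i) hi.symm⟩

/-- `T` is a spanning tree of the cube (as a graph on all the vertices of the cube). -/
def IsSpanningTree (T : SimpleGraph (Finset ι)) : Prop :=
  T ≤ cube ι ∧ T.IsTree

/-- The set of spanning trees of the cube. -/
abbrev SpanningTree (ι : Type*) [DecidableEq ι] : Type _ :=
  {T : SimpleGraph (Finset ι) // IsSpanningTree T}

/-- The edges `{X, X ∆ {i}}` of `T`, that is, the edges of `T` in direction `i`. -/
def edgesInDir (T : SimpleGraph (Finset ι)) (i : ι) : Set (Sym2 (Finset ι)) :=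
  {e | e ∈ T.edgeSet ∧ ∃ X : Finset ι, e = s(X, X ∆ {i})}

/-- The signature of `T`: its entry at `i` is the number of edges of `T` in direction `i`. -/
noncomputable def sig (T : SimpleGraph (Finset ι)) : ι → ℕ :=
  fun i => (edgesInDir T i).ncard

/-- `S` is a signature of the cube: it is the signature of some spanning tree. -/
def IsSignature (S : ι → ℕ) : Prop :=
  ∃ T : SimpleGraph (Finset ι), IsSpanningTree T ∧ sig T = S

/-- The automorphism `σ_i : X ↦ X ∆ {i}` of the cube, acting on (potential) edges. -/
def slide (i : ι) (e : Sym2 (Finset ι)) : Sym2 (Finset ι) :=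
  Sym2.map (fun X => X ∆ {i}) e

/-- `T'` is obtained from `T` by a single edge slide: `T' = T - e + σ_i(e)`, where `e` is an edge of
`T` in a direction `j ≠ i` and `σ_i(e)` is not an edge of `T`. -/
def IsEdgeSlide (T T' : SimpleGraph (Finset ι)) : Prop :=
  ∃ i j : ι, j ≠ i ∧ ∃ e ∈ edgesInDir T j, slide i e ∉ T.edgeSet ∧
    T'.edgeSet = insert (slide i e) (T.edgeSet \ {e})

theorem slide_slide (i : ι) (e : Sym2 (Finset ι)) : slide i (slide i e) = e := by
  induction e with
  | _ X Y => simp [slide, symmDiff_symmDiff_cancel_right]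

theorem IsEdgeSlide.symm {T T' : SimpleGraph (Finset ι)} (h : IsEdgeSlide T T') :
    IsEdgeSlide T' T := by
  obtain ⟨i, j, hij, e, ⟨heT, X, rfl⟩, hs, hT'⟩ := h
  have hne : s(X, X ∆ {j}) ≠ slide i s(X, X ∆ {j}) := fun h => hs (h ▸ heT)
  refine ⟨i, j, hij, slide i s(X, X ∆ {j}), ⟨?_, X ∆ {i}, ?_⟩, ?_, ?_⟩
  · rw [hT']
    exact Set.mem_insert _ _
  · simp only [slide, Sym2.map_mk]
    rw [symmDiff_right_comm]
  · rw [slide_slide, hT']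
    rintro (h | h)
    · exact hne h
    · exact h.2 rfl
  · rw [slide_slide, hT', Set.insert_sdiff_of_mem _ (Set.mem_singleton _),
      Set.sdiff_singleton_eq_self (fun h => hs h.1), Set.insert_sdiff_singleton,
      Set.insert_eq_of_mem heT]

theorem not_isEdgeSlide_self (T : SimpleGraph (Finset ι)) : ¬ IsEdgeSlide T T := by
  rintro ⟨i, j, -, e, -, hs, hT⟩
  exact hs (hT ▸ Set.mem_insert _ _)

/-- The edge slide graph of the cube: the graph on its spanning trees in which two trees are
adjacent if and only if they are related by a single edge slide. -/
def edgeSlideGraph (ι : Type*) [DecidableEq ι] : SimpleGraph (SpanningTree ι) where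
  Adj T T' := IsEdgeSlide T.1 T'.1
  symm := ⟨fun _ _ h => IsEdgeSlide.symm h⟩
  loopless := ⟨fun T h => not_isEdgeSlide_self T.1 h⟩

/-- The set of spanning trees of the cube with signature `S`. -/
def treesWithSig (S : ι → ℕ) : Set (SpanningTree ι) :=
  {T : SpanningTree ι | sig T.1 = S}

/-- The edge slide graph `E(S)` of `S`: the subgraph of the edge slide graph of the cube induced by
the spanning trees with signature `S`. -/
def edgeSlideGraphSig (S : ι → ℕ) : SimpleGraph (treesWithSig S) :=
  (edgeSlideGraph ι).induce (treesWithSig S)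

end Cube

section Classification

/-- `S` is reducible: there is a proper nonempty set `R` of directions with
`∑ i ∈ R, S i = 2 ^ |R| - 1`. -/
def IsReducible {ι : Type*} [Fintype ι] (S : ι → ℕ) : Prop :=
  ∃ R : Finset ι, R.Nonempty ∧ R ≠ Finset.univ ∧ ∑ i ∈ R, S i = 2 ^ R.card - 1

/-- `S` is irreducible: it is not reducible. -/
def IsIrreducible {ι : Type*} [Fintype ι] (S : ι → ℕ) : Prop :=
  ¬ IsReducible S

/-- The excess of `S` at `k`: the minimum of `∑ i ∈ K, S i` over the `k`-element sets `K` of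
directions, minus `2 ^ k - 1`. It is meaningful for `k ≤ n` only. -/
noncomputable def excess {n : ℕ} (S : Fin n → ℕ) (k : ℕ) : ℤ :=
  ((sInf {m : ℕ | ∃ K : Finset (Fin n), K.card = k ∧ ∑ i ∈ K, S i = m} : ℕ) : ℤ) - (2 ^ k - 1)

/-- The length `s` of the unsaturated part of a signature `S` of the `n`-cube: the least `s` with
`1 ≤ s ≤ n` such that the excess of `S` at `k` vanishes for all `s ≤ k ≤ n`. -/
noncomputable def unsatLength {n : ℕ} (S : Fin n → ℕ) : ℕ :=
  sInf {s : ℕ | 1 ≤ s ∧ s ≤ n ∧ ∀ k, s ≤ k → k ≤ n → excess S k = 0}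

/-- The directions that occur in the unsaturated part of `S`: those that are put in the first
`unsatLength S` places when `S` is sorted into nondecreasing order. -/
noncomputable def unsatDirs {n : ℕ} (S : Fin n → ℕ) : Finset (Fin n) :=
  Finset.univ.filter fun i => ((Tuple.sort S).symm i : ℕ) < unsatLength S

/-- The unsaturated part of `S`: the restriction of `S` to the directions occurring in it. -/
noncomputable def unsat {n : ℕ} (S : Fin n → ℕ) : {i // i ∈ unsatDirs S} → ℕ :=
  fun i => S i

/-- A reducible signature is quasi-irreducible if its unsaturated part is irreducible. -/
def IsQuasiIrreducible {n : ℕ} (S : Fin n → ℕ) : Prop :=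
  IsReducible S ∧ IsIrreducible (unsat S)

/-- A reducible signature is strictly reducible if it is not quasi-irreducible, that is, if its
unsaturated part is reducible. -/
def IsStrictlyReducible {n : ℕ} (S : Fin n → ℕ) : Prop :=
  IsReducible S ∧ ¬ IsQuasiIrreducible S

end Classification

end CubeTree

/-! ### Edge counts of forests -/

namespace CubeTree

/-! Call a set `R` of directions tight if its entries sum to `2 ^ |R| - 1`, and call the subcubes
`{Y | Y ∩ R = X}`, for `X ⊆ R`, the copies. If `R` is tight, a spanning tree has `2 ^ |R| * (2 ^
|Rᶜ| - 1)` edges in directions outside `R`, while acyclicity allows at most `2 ^ |Rᶜ| - 1` in each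
copy. Hence the tree spans every copy, no slide carries an edge from one copy to another, and the
number of edges of each direction in each copy is constant on components
(`ncard_copyEdges_eq_of_reachable`).

It remains to find two trees with signature `S` that differ in these numbers. Hall's theorem
realizes every `Feasible` tuple (`Feasible.exists_isSectionOn`), and this can be done copy by copy
(`exists_isSectionOn_univ`). A given family of copy signatures is altered by exchanging two unequal
members; if all are equal, one unit is moved from `j` to `i` in half of the copies and from `i` to
`j` in the rest (`exists_ne_of_feasible_family`). The latter needs two directions outside `R` that
no tight set containing `R` separates. Tight sets form a chain (`subset_or_subset_of_tight`), and
strict reducibility gives a step of size at least two in it, ending at the unsaturated length; `i`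
and `j` come from that step. -/

theorem ncard_biUnion_of_pairwiseDisjoint {α β : Type*} [Finite β] (s : Finset α)
    (f : α → Set β) (hf : (s : Set α).PairwiseDisjoint f) :
    (⋃ a ∈ s, f a).ncard = ∑ a ∈ s, (f a).ncard := by
  classical
  induction s using Finset.induction_on with
  | empty => simp
  | insert a s ha ih =>
    rw [Finset.sum_insert ha, Finset.set_biUnion_insert, Set.ncard_union_eq, ih]
    · exact hf.subset (by simp)
    · simp only [Set.disjoint_iUnion_right]
      intro b hb
      exact hf (by simp) (by simp [hb]) (by rintro rfl; exact ha hb)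

/-- A forest extends to a spanning tree of the complete graph. -/
theorem ncard_edgeSet_add_one_le_of_isAcyclic {V : Type*} [Finite V] [Nonempty V]
    {G : SimpleGraph V} (hG : G.IsAcyclic) : G.edgeSet.ncard + 1 ≤ Nat.card V := by
  obtain ⟨T, hGT, -, hT⟩ :=
    SimpleGraph.connected_top.exists_isTree_le_of_le_of_isAcyclic le_top hG
  have h := (SimpleGraph.isTree_iff_connected_and_card.1 hT).2
  rw [← h, Nat.card_coe_set_eq]
  exact Nat.add_le_add_right
    (Set.ncard_le_ncard (SimpleGraph.edgeSet_mono hGT) (Set.toFinite _)) 1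

theorem ncard_edges_within_add_one_le {V : Type*} [Finite V] {G : SimpleGraph V}
    (hG : G.IsAcyclic) {s : Set V} (hs : s.Nonempty) :
    {e ∈ G.edgeSet | ∀ v ∈ e, v ∈ s}.ncard + 1 ≤ s.ncard := by
  have : Nonempty s := hs.to_subtype
  refine le_trans (Nat.add_le_add_right ?_ 1)
    (ncard_edgeSet_add_one_le_of_isAcyclic (hG.induce s))
  refine le_trans (Set.ncard_le_ncard ?_ (Set.toFinite _))
    (Set.ncard_image_le (f := Sym2.map Subtype.val) (Set.toFinite _))
  rintro e ⟨he, hes⟩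
  induction e with
  | _ x y =>
    exact ⟨s(⟨x, hes x (by simp)⟩, ⟨y, hes y (by simp)⟩), by simpa using he, by simp⟩

/-! ### The invariant: edge counts in the copies of a tight set -/

section

variable {ι : Type*} [DecidableEq ι]

theorem eq_of_mk_symmDiff_eq {X Y : Finset ι} {i j : ι}
    (h : s(X, X ∆ {i}) = s(Y, Y ∆ {j})) : i = j := by
  rcases Sym2.eq_iff.1 h with ⟨rfl, h⟩ | ⟨rfl, h⟩
  · exact Finset.singleton_injective (symmDiff_right_injective _ h)
  · rw [symmDiff_assoc] at h
    have := symmDiff_eq_left.1 h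
    exact (Finset.singleton_injective (symmDiff_eq_bot.1 this)).symm

/-- The edges of `T` in direction `j` that lie in the subcube of the vertices `Y` with
`Y ∩ R = X`. -/
def copyEdges (T : SimpleGraph (Finset ι)) (R X : Finset ι) (j : ι) : Set (Sym2 (Finset ι)) :=
  {e ∈ edgesInDir T j | ∀ Y ∈ e, Y ∩ R = X}

theorem disjoint_edgesInDir (T : SimpleGraph (Finset ι)) {i j : ι} (hij : i ≠ j) :
    Disjoint (edgesInDir T i) (edgesInDir T j) := by
  rw [Set.disjoint_left]
  rintro _ ⟨-, X, rfl⟩ ⟨-, Y, h⟩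
  exact hij (eq_of_mk_symmDiff_eq h)

theorem symmDiff_singleton_inter {R : Finset ι} {j : ι} (hj : j ∉ R) (Y : Finset ι) :
    Y ∆ {j} ∩ R = Y ∩ R := by
  ext a
  simp only [Finset.mem_inter, Finset.mem_symmDiff, Finset.mem_singleton]
  constructor
  · rintro ⟨h, ha⟩
    refine ⟨?_, ha⟩
    have : a ≠ j := by rintro rfl; exact hj ha
    tauto
  · rintro ⟨h, ha⟩
    have : a ≠ j := by rintro rfl; exact hj ha
    tauto

variable [Fintype ι]

theorem union_inter_eq_of_subset {R X Z : Finset ι} (hX : X ⊆ R) (hZ : Z ⊆ Rᶜ) :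
    (X ∪ Z) ∩ R = X := by
  rw [Finset.union_inter_distrib_right, Finset.inter_eq_left.2 hX,
    Finset.disjoint_iff_inter_eq_empty.1 (Finset.subset_compl_iff_disjoint_right.1 hZ),
    Finset.union_empty]

theorem union_sdiff_eq_of_subset {R X Z : Finset ι} (hX : X ⊆ R) (hZ : Z ⊆ Rᶜ) :
    (X ∪ Z) \ R = Z := by
  rw [Finset.union_sdiff_distrib, Finset.sdiff_eq_empty_iff_subset.2 hX, Finset.empty_union,
    Finset.sdiff_eq_self_of_disjoint (Finset.subset_compl_iff_disjoint_right.1 hZ)]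

theorem ncard_inter_eq {R X : Finset ι} (hX : X ⊆ R) :
    {Y : Finset ι | Y ∩ R = X}.ncard = 2 ^ Rᶜ.card := by
  rw [← Finset.card_powerset, ← Set.ncard_coe_finset]
  refine Set.ncard_congr (fun Y _ => Y \ R) ?_ ?_ ?_
  · intro Y _
    simp only [Finset.coe_powerset, Set.mem_preimage, Set.mem_powerset_iff, Finset.coe_subset]
    intro a
    simp
  · intro Y Z hY hZ h
    rw [← Finset.sdiff_union_inter Y R, ← Finset.sdiff_union_inter Z R, h, hY, hZ]
  · intro Z hZ
    simp only [Finset.coe_powerset, Set.mem_preimage, Set.mem_powerset_iff,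
      Finset.coe_subset] at hZ
    exact ⟨X ∪ Z, union_inter_eq_of_subset hX hZ, union_sdiff_eq_of_subset hX hZ⟩

theorem sum_ncard_copyEdges_add_one_le {T : SimpleGraph (Finset ι)} (hT : T.IsAcyclic)
    {R X : Finset ι} (hX : X ⊆ R) :
    ∑ j ∈ Rᶜ, (copyEdges T R X j).ncard + 1 ≤ 2 ^ Rᶜ.card := by
  rw [← ncard_inter_eq hX, ← ncard_biUnion_of_pairwiseDisjoint]
  · refine le_trans (Nat.add_le_add_right (Set.ncard_le_ncard ?_ (Set.toFinite _)) 1)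
      (ncard_edges_within_add_one_le hT ⟨X, Finset.inter_eq_left.2 hX⟩)
    simp only [Set.iUnion_subset_iff]
    exact fun j _ e he => ⟨he.1.1, he.2⟩
  · exact fun i _ j _ hij => (disjoint_edgesInDir T hij).mono (fun e he => he.1) (fun e he => he.1)

theorem sum_powerset_ncard_copyEdges (T : SimpleGraph (Finset ι)) {R : Finset ι} {j : ι}
    (hj : j ∉ R) : ∑ X ∈ R.powerset, (copyEdges T R X j).ncard = sig T j := by
  rw [← ncard_biUnion_of_pairwiseDisjoint, sig]
  · congr 1
    ext e
    simp only [Set.mem_iUnion, Finset.mem_powerset, exists_prop]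
    constructor
    · rintro ⟨X, -, he⟩
      exact he.1
    · intro he
      obtain ⟨-, Y, rfl⟩ := id he
      refine ⟨Y ∩ R, Finset.inter_subset_right, he, ?_⟩
      simp [symmDiff_singleton_inter hj]
  · intro X _ X' _ hXX'
    rw [Function.onFun, Set.disjoint_left]
    rintro _ ⟨⟨-, Y, rfl⟩, h⟩ ⟨-, h'⟩
    exact hXX' ((h Y (by simp)).symm.trans (h' Y (by simp)))

theorem sum_sig_add_one {T : SimpleGraph (Finset ι)} (hT : IsSpanningTree T) :
    ∑ i, sig T i + 1 = 2 ^ Fintype.card ι := by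
  have h := (SimpleGraph.isTree_iff_connected_and_card.1 hT.2).2
  rw [Nat.card_eq_fintype_card (α := Finset ι), Fintype.card_finset, Nat.card_coe_set_eq] at h
  rw [← h]
  simp only [sig]
  rw [← ncard_biUnion_of_pairwiseDisjoint _ _ fun i _ j _ hij => disjoint_edgesInDir T hij]
  congr 2
  ext e
  simp only [Finset.mem_univ, Set.iUnion_true, Set.mem_iUnion]
  refine ⟨fun ⟨i, he⟩ => he.1, fun he => ?_⟩
  induction e with
  | _ X Y =>
    obtain ⟨i, hi⟩ := hT.1 he
    exact ⟨i, he, X, by rw [← hi, symmDiff_symmDiff_cancel_left]⟩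

/-- Double count of all edges of `T`, arranged without subtraction. With the bound for a single copy
it yields both Hall's condition for signatures and, for tight `R`, equality in every copy. -/
theorem sum_sum_ncard_copyEdges {T : SimpleGraph (Finset ι)} (hT : IsSpanningTree T)
    (R : Finset ι) :
    ∑ X ∈ R.powerset, (∑ j ∈ Rᶜ, (copyEdges T R X j).ncard + 1) + (∑ i ∈ R, sig T i + 1)
      = 2 ^ R.card * 2 ^ Rᶜ.card + 2 ^ R.card := by
  rw [Finset.sum_add_distrib, Finset.sum_comm, Finset.sum_congr rfl fun j hj =>
    sum_powerset_ncard_copyEdges T (Finset.mem_compl.1 hj), ← pow_add,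
    Finset.card_add_card_compl, ← sum_sig_add_one hT, ← Finset.sum_add_sum_compl R]
  simp
  ring

theorem two_pow_card_le_sum_sig_add_one {T : SimpleGraph (Finset ι)} (hT : IsSpanningTree T)
    (R : Finset ι) : 2 ^ R.card ≤ ∑ i ∈ R, sig T i + 1 := by
  have h := sum_sum_ncard_copyEdges hT R
  have h' := Finset.sum_le_sum fun X (hX : X ∈ R.powerset) =>
    sum_ncard_copyEdges_add_one_le hT.2.isAcyclic (Finset.mem_powerset.1 hX)
  rw [Finset.sum_const, Finset.card_powerset, smul_eq_mul] at h'
  omega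

theorem sum_ncard_copyEdges_add_one {T : SimpleGraph (Finset ι)} (hT : IsSpanningTree T)
    {R : Finset ι} (hR : ∑ i ∈ R, sig T i + 1 = 2 ^ R.card) {X : Finset ι} (hX : X ⊆ R) :
    ∑ j ∈ Rᶜ, (copyEdges T R X j).ncard + 1 = 2 ^ Rᶜ.card := by
  have h := sum_sum_ncard_copyEdges hT R
  rw [hR, Nat.add_right_cancel_iff, ← Finset.card_powerset, ← smul_eq_mul,
    ← Finset.sum_const] at h
  exact (Finset.sum_eq_sum_iff_of_le fun X hX => sum_ncard_copyEdges_add_one_le hT.2.isAcyclic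
    (Finset.mem_powerset.1 hX)).1 h X (Finset.mem_powerset.2 hX)

theorem ncard_copyEdges_eq_of_isEdgeSlide {T T' : SimpleGraph (Finset ι)}
    (hT : IsSpanningTree T) (hT' : IsSpanningTree T') (h : IsEdgeSlide T T') {R : Finset ι}
    (hR : ∑ i ∈ R, sig T i + 1 = 2 ^ R.card) (X : Finset ι) {k : ι} (hk : k ∉ R) :
    (copyEdges T R X k).ncard = (copyEdges T' R X k).ncard := by
  obtain ⟨i, j, hji, e, ⟨heT, Y, rfl⟩, hs, hE⟩ := h
  have hslide : slide i s(Y, Y ∆ {j}) = s(Y ∆ {i}, Y ∆ {i} ∆ {j}) := by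
    rw [slide, Sym2.map_mk, symmDiff_right_comm]
  rw [hslide] at hs hE
  set f := s(Y ∆ {i}, Y ∆ {i} ∆ {j}) with hf
  set e := s(Y, Y ∆ {j}) with he
  have hdir : ∀ k ≠ j, edgesInDir T' k = edgesInDir T k := by
    intro k hkj
    ext g
    simp only [edgesInDir, hE, Set.mem_ofPred_eq, and_congr_left_iff]
    rintro ⟨Z, rfl⟩
    have h1 : s(Z, Z ∆ {k}) ≠ f := fun h => hkj (eq_of_mk_symmDiff_eq h)
    have h2 : s(Z, Z ∆ {k}) ≠ e := fun h => hkj (eq_of_mk_symmDiff_eq h)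
    simp [h1, h2]
  have hdirj : edgesInDir T' j = insert f (edgesInDir T j \ {e}) := by
    ext g
    simp only [edgesInDir, hE, Set.mem_ofPred_eq, Set.mem_insert_iff, Set.mem_sdiff,
      Set.mem_singleton_iff]
    have : g = f → ∃ X, g = s(X, X ∆ {j}) := fun h => ⟨_, h⟩
    tauto
  have heT' : e ∈ edgesInDir T j := ⟨heT, Y, rfl⟩
  have hfT : f ∉ edgesInDir T j := fun h => hs h.1
  rcases ne_or_eq k j with hkj | rfl
  · simp only [copyEdges, hdir k hkj]
  have hin : ∀ Z X, (∀ W ∈ s(Z, Z ∆ {k}), W ∩ R = X) ↔ Z ∩ R = X := by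
    intro Z X
    simp [symmDiff_singleton_inter hk]
  by_cases hi : i ∈ R
  -- The slid edge would enter the copy of `Y ∆ {i}`, which loses nothing because `e` lies in
  -- another copy. That copy already holds the maximal number of edges.
  · exfalso
    have hXR : Y ∆ {i} ∩ R ⊆ R := Finset.inter_subset_right
    have hYi : Y ∩ R ≠ Y ∆ {i} ∩ R := by
      intro h
      have := congrArg (i ∈ ·) h
      simp only [Finset.mem_inter, hi, Finset.mem_symmDiff, Finset.mem_singleton, and_true,
        eq_iff_iff] at this
      tauto
    have h1 := sum_ncard_copyEdges_add_one hT hR hXR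
    have h2 := sum_ncard_copyEdges_add_one_le hT'.2.isAcyclic hXR
    refine absurd (h2.trans h1.ge) (not_le.2 (Nat.add_lt_add_right ?_ 1))
    have hlt : (copyEdges T R (Y ∆ {i} ∩ R) k).ncard < (copyEdges T' R (Y ∆ {i} ∩ R) k).ncard := by
      refine Set.ncard_lt_ncard ((Set.ssubset_iff_of_subset ?_).2 ⟨f, ⟨?_, ?_⟩, fun h => hfT h.1⟩)
        (Set.toFinite _)
      · rintro g ⟨hg, hg'⟩
        refine ⟨?_, hg'⟩
        rw [hdirj]
        refine Or.inr ⟨hg, ?_⟩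
        rintro rfl
        exact hYi ((hin _ _).1 hg')
      · rw [hdirj]
        exact Set.mem_insert _ _
      · exact (hin _ _).2 rfl
    refine Finset.sum_lt_sum (fun l _ => ?_) ⟨k, Finset.mem_compl.2 hk, hlt⟩
    rcases ne_or_eq l k with hl | rfl
    · simp only [copyEdges, hdir l hl, le_refl]
    · exact hlt.le
  -- Here `e` and its slide lie in the same copy, so one replaces the other there.
  · have hYi : Y ∆ {i} ∩ R = Y ∩ R := symmDiff_singleton_inter hi Y
    by_cases hY : Y ∩ R = X
    · have : copyEdges T' R X k = insert f (copyEdges T R X k \ {e}) := by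
        ext g
        have : g = f → ∀ W ∈ g, W ∩ R = X := by
          rintro rfl
          exact (hin _ _).2 (hYi.trans hY)
        simp only [copyEdges, hdirj, Set.mem_ofPred_eq, Set.mem_insert_iff, Set.mem_sdiff,
          Set.mem_singleton_iff]
        tauto
      rw [this, Set.ncard_insert_of_notMem (fun h => hfT h.1.1),
        Set.ncard_sdiff_singleton_add_one]
      exact ⟨heT', (hin _ _).2 hY⟩
    · congr 1
      ext g
      have h1 : g = f → ¬ ∀ W ∈ g, W ∩ R = X := by
        rintro rfl h
        exact hY (hYi.symm.trans ((hin _ _).1 h))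
      have h2 : g = e → ¬ ∀ W ∈ g, W ∩ R = X := by
        rintro rfl h
        exact hY ((hin _ _).1 h)
      simp only [copyEdges, hdirj, Set.mem_ofPred_eq, Set.mem_insert_iff, Set.mem_sdiff,
        Set.mem_singleton_iff]
      tauto

theorem ncard_copyEdges_eq_of_reachable {S : ι → ℕ} {T T' : treesWithSig S}
    (h : (edgeSlideGraphSig S).Reachable T T') {R : Finset ι}
    (hR : ∑ i ∈ R, S i + 1 = 2 ^ R.card) (X : Finset ι) {k : ι} (hk : k ∉ R) :
    (copyEdges T.1.1 R X k).ncard = (copyEdges T'.1.1 R X k).ncard := by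
  obtain ⟨p⟩ := h
  induction p with
  | nil => rfl
  | cons hadj _ ih =>
    rename_i T₁ _ _ _
    refine Eq.trans ?_ ih
    refine ncard_copyEdges_eq_of_isEdgeSlide T₁.1.2 (Subtype.property _) hadj ?_ X hk
    rw [show sig T₁.1.1 = S from T₁.2]
    exact hR

end

end CubeTree

/-! ### Upright trees with prescribed edge counts -/

namespace CubeTree

section

variable {ι : Type*} [DecidableEq ι]

/-- `φ` selects an element of every nonempty subset of `D`. -/
def IsSectionOn (D : Finset ι) (φ : Finset ι → ι) : Prop :=
  ∀ Y ⊆ D, Y.Nonempty → φ Y ∈ Y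

/-- Hall's condition for `a` to count the values of a section on the nonempty subsets of `D`. -/
structure Feasible (D : Finset ι) (a : ι → ℕ) : Prop where
  le : ∀ L ⊆ D, 2 ^ L.card ≤ ∑ i ∈ L, a i + 1
  eq : ∑ i ∈ D, a i + 1 = 2 ^ D.card

theorem card_nonempty_powerset_add_one (D : Finset ι) :
    (D.powerset.filter Finset.Nonempty).card + 1 = 2 ^ D.card := by
  rw [← Finset.card_powerset, ← Finset.card_erase_add_one (Finset.empty_mem_powerset D)]
  congr 2
  ext Y
  simp [Finset.nonempty_iff_ne_empty, and_comm]

/-- Hall's theorem with `a i` slots for each direction `i`: every nonempty `Y` picks a slot of one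
of its elements. A family with union `L` has at most `2 ^ |L| - 1` members and sees all the slots
over `L`. The totals agree, so every slot is used. -/
theorem Feasible.exists_isSectionOn [Nonempty ι] {D : Finset ι} {a : ι → ℕ} (h : Feasible D a) :
    ∃ φ : Finset ι → ι, IsSectionOn D φ ∧
      ∀ i ∈ D, (D.powerset.filter fun Y => Y.Nonempty ∧ φ Y = i).card = a i := by
  classical
  let P := D.powerset.filter Finset.Nonempty
  obtain ⟨f, hf, hft⟩ := (Finset.all_card_le_biUnion_card_iff_exists_injective
    fun Y : P => Y.1.sigma fun i => Finset.range (a i)).1 (by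
      intro s
      let L := s.biUnion fun Y => Y.1
      have hL : L ⊆ D := Finset.biUnion_subset.2 fun Y _ =>
        Finset.mem_powerset.1 (Finset.mem_filter.1 Y.2).1
      have hU : (s.biUnion fun Y : P => Y.1.sigma fun i => Finset.range (a i))
          = L.sigma fun i => Finset.range (a i) := by
        ext x
        simp only [Finset.mem_biUnion, Finset.mem_sigma, L]
        grind
      have hs : s.card ≤ (L.powerset.filter Finset.Nonempty).card := by
        rw [← Finset.card_map (Function.Embedding.subtype _)]
        refine Finset.card_le_card fun Y hY => ?_
        obtain ⟨Z, hZ, rfl⟩ := Finset.mem_map.1 hY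
        exact Finset.mem_filter.2 ⟨Finset.mem_powerset.2
          (Finset.subset_biUnion_of_mem (fun Y : P => Y.1) hZ), (Finset.mem_filter.1 Z.2).2⟩
      rw [hU, Finset.card_sigma]
      simp only [Finset.card_range]
      have := h.le L hL
      have := card_nonempty_powerset_add_one L
      omega)
  let φ : Finset ι → ι := fun Y => if hY : Y ∈ P then (f ⟨Y, hY⟩).1 else Classical.arbitrary ι
  have hφ : ∀ Y (hY : Y ∈ P), φ Y = (f ⟨Y, hY⟩).1 := fun Y hY => dif_pos hY
  have hsec : ∀ Y ∈ P, φ Y ∈ Y := fun Y hY => by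
    rw [hφ Y hY]
    exact (Finset.mem_sigma.1 (hft ⟨Y, hY⟩)).1
  refine ⟨φ, fun Y hY hne => hsec Y (by simp [P, hY, hne]), ?_⟩
  have hle : ∀ i ∈ D, (P.filter fun Y => φ Y = i).card ≤ a i := by
    intro i _
    rw [← Finset.card_range (a i)]
    refine Finset.card_le_card_of_injOn
      (fun Y => if hY : Y ∈ P then (f ⟨Y, hY⟩).2 else 0) ?_ ?_
    · intro Y hY
      obtain ⟨hY, hi⟩ := Finset.mem_filter.1 (Finset.mem_coe.1 hY)
      have := (Finset.mem_sigma.1 (hft ⟨Y, hY⟩)).2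
      rw [← hφ Y hY, hi] at this
      simpa [hY] using this
    · intro Y hY Z hZ hYZ
      obtain ⟨hY, hi⟩ := Finset.mem_filter.1 (Finset.mem_coe.1 hY)
      obtain ⟨hZ, hj⟩ := Finset.mem_filter.1 (Finset.mem_coe.1 hZ)
      simp only [hY, hZ, dif_pos] at hYZ
      rw [hφ Y hY] at hi
      rw [hφ Z hZ] at hj
      exact congrArg Subtype.val (hf (Sigma.ext (hi.trans hj.symm) (heq_of_eq hYZ)))
  have hsum : ∑ i ∈ D, (P.filter fun Y => φ Y = i).card = ∑ i ∈ D, a i := by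
    rw [← Finset.card_eq_sum_card_fiberwise]
    · have := h.eq
      have := card_nonempty_powerset_add_one D
      simp only [P]
      omega
    · intro Y hY
      exact Finset.mem_powerset.1 (Finset.mem_filter.1 hY).1 (hsec Y hY)
  intro i hi
  rw [← (Finset.sum_eq_sum_iff_of_le hle).1 hsum i hi, Finset.filter_filter]

/-- The spanning tree of the cube that joins every nonempty `Y` to `Y.erase (φ Y)`. -/
def upright (φ : Finset ι → ι) : SimpleGraph (Finset ι) :=
  SimpleGraph.fromEdgeSet ((fun Y => s(Y, Y ∆ {φ Y})) '' {Y | Y.Nonempty})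

theorem symmDiff_singleton_of_mem {Y : Finset ι} {i : ι} (h : i ∈ Y) :
    Y ∆ {i} = Y.erase i := by
  ext a
  simp only [Finset.mem_symmDiff, Finset.mem_singleton, Finset.mem_erase]
  have : a = i → a ∈ Y := by rintro rfl; exact h
  tauto

theorem edgeSet_upright (φ : Finset ι → ι) :
    (upright φ).edgeSet = (fun Y => s(Y, Y ∆ {φ Y})) '' {Y | Y.Nonempty} := by
  rw [upright, SimpleGraph.edgeSet_fromEdgeSet, sdiff_eq_left, Set.disjoint_left]
  rintro _ ⟨Y, -, rfl⟩ h
  have h' : Y = Y ∆ {φ Y} := by simpa using h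
  exact Finset.singleton_ne_empty _ (symmDiff_eq_left.1 h'.symm)

theorem edgesInDir_upright (φ : Finset ι → ι) (i : ι) :
    edgesInDir (upright φ) i =
      (fun Y => s(Y, Y ∆ {φ Y})) '' {Y | Y.Nonempty ∧ φ Y = i} := by
  ext e
  simp only [edgesInDir, edgeSet_upright]
  constructor
  · rintro ⟨⟨Y, hY, rfl⟩, X, h⟩
    exact ⟨Y, ⟨hY, eq_of_mk_symmDiff_eq h⟩, rfl⟩
  · rintro ⟨Y, ⟨hY, rfl⟩, rfl⟩
    exact ⟨⟨Y, hY, rfl⟩, Y, rfl⟩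

variable [Fintype ι]

theorem injOn_upright {φ : Finset ι → ι} (hφ : IsSectionOn Finset.univ φ) :
    Set.InjOn (fun Y => s(Y, Y ∆ {φ Y})) {Y : Finset ι | Y.Nonempty} := by
  intro Y hY Z hZ h
  simp only [symmDiff_singleton_of_mem (hφ Y (Finset.subset_univ _) hY),
    symmDiff_singleton_of_mem (hφ Z (Finset.subset_univ _) hZ)] at h
  rcases Sym2.eq_iff.1 h with h | ⟨h, h'⟩
  · exact h.1
  · refine Finset.Subset.antisymm ?_ ?_
    · rw [h]
      exact Finset.erase_subset _ _
    · rw [← h']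
      exact Finset.erase_subset _ _

theorem sig_upright {φ : Finset ι → ι} (hφ : IsSectionOn Finset.univ φ) (i : ι) :
    sig (upright φ) i = (Finset.univ.filter fun Y => Y.Nonempty ∧ φ Y = i).card := by
  rw [sig, edgesInDir_upright, ((injOn_upright hφ).mono fun Y hY => hY.1).ncard_image,
    ← Set.ncard_coe_finset]
  simp

theorem ncard_copyEdges_upright {φ : Finset ι → ι} (hφ : IsSectionOn Finset.univ φ)
    {R : Finset ι} (X : Finset ι) {k : ι} (hk : k ∉ R) :
    (copyEdges (upright φ) R X k).ncard =
      (Finset.univ.filter fun Y => Y.Nonempty ∧ φ Y = k ∧ Y ∩ R = X).card := by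
  have : copyEdges (upright φ) R X k =
      (fun Y => s(Y, Y ∆ {φ Y})) '' {Y | Y.Nonempty ∧ φ Y = k ∧ Y ∩ R = X} := by
    ext e
    simp only [copyEdges, edgesInDir_upright]
    constructor
    · rintro ⟨⟨Y, ⟨hY, hYk⟩, rfl⟩, h⟩
      exact ⟨Y, ⟨hY, hYk, h Y (by simp)⟩, rfl⟩
    · rintro ⟨Y, ⟨hY, rfl, rfl⟩, rfl⟩
      refine ⟨⟨Y, ⟨hY, rfl⟩, rfl⟩, ?_⟩
      simp [symmDiff_singleton_inter hk]
  rw [this, ((injOn_upright hφ).mono fun Y hY => hY.1).ncard_image,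
    ← Set.ncard_coe_finset]
  simp

/-- Repeated erasure leads every vertex to `∅`, and there is one edge per nonempty set, its upper
end. -/
theorem isSpanningTree_upright {φ : Finset ι → ι} (hφ : IsSectionOn Finset.univ φ) :
    IsSpanningTree (upright φ) := by
  refine ⟨?_, SimpleGraph.isTree_iff_connected_and_card.2 ⟨?_, ?_⟩⟩
  · rw [← SimpleGraph.edgeSet_subset_edgeSet, edgeSet_upright]
    rintro _ ⟨Y, -, rfl⟩
    exact ⟨φ Y, by rw [symmDiff_symmDiff_cancel_left]⟩
  · have : ∀ Y, (upright φ).Reachable Y ∅ := by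
      intro Y
      induction Y using Finset.strongInduction with
      | H Y ih =>
        rcases Y.eq_empty_or_nonempty with rfl | hY
        · exact SimpleGraph.Reachable.refl _
        · have hm := hφ Y (Finset.subset_univ _) hY
          refine SimpleGraph.Reachable.trans ?_ (ih _ (Finset.erase_ssubset hm))
          refine SimpleGraph.Adj.reachable ?_
          rw [← SimpleGraph.mem_edgeSet, edgeSet_upright, ← symmDiff_singleton_of_mem hm]
          exact ⟨Y, hY, rfl⟩
    exact ⟨fun Y Z => (this Y).trans (this Z).symm⟩
  · rw [Nat.card_coe_set_eq, edgeSet_upright, (injOn_upright hφ).ncard_image,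
      Nat.card_eq_fintype_card, Fintype.card_finset, ← Finset.card_univ,
      ← card_nonempty_powerset_add_one, ← Set.ncard_coe_finset]
    simp

theorem card_filter_inter_eq (φ : Finset ι → ι) (R : Finset ι) (k : ι) :
    ∑ X ∈ R.powerset, (Finset.univ.filter fun Y => Y.Nonempty ∧ φ Y = k ∧ Y ∩ R = X).card =
      (Finset.univ.filter fun Y : Finset ι => Y.Nonempty ∧ φ Y = k).card := by
  rw [Finset.card_eq_sum_card_fiberwise (f := fun Y => Y ∩ R) (t := R.powerset)]
  · refine Finset.sum_congr rfl fun X _ => ?_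
    rw [Finset.filter_filter]
    simp only [and_assoc]
  · intro Y _
    simp

/-- Sections of the subcubes parallel to `Rᶜ` can be glued along a section on `R`. -/
theorem exists_isSectionOn_univ [Nonempty ι] {R : Finset ι} {S : ι → ℕ} (hS : Feasible R S)
    {b : Finset ι → ι → ℕ} (hb : ∀ X ⊆ R, Feasible Rᶜ (b X))
    (hbS : ∀ k ∉ R, ∑ X ∈ R.powerset, b X k = S k) :
    ∃ φ : Finset ι → ι, IsSectionOn Finset.univ φ ∧
      (∀ k, (Finset.univ.filter fun Y => Y.Nonempty ∧ φ Y = k).card = S k) ∧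
      ∀ X ⊆ R, ∀ k ∉ R,
        (Finset.univ.filter fun Y => Y.Nonempty ∧ φ Y = k ∧ Y ∩ R = X).card = b X k := by
  obtain ⟨φ₀, hφ₀, hS₀⟩ := hS.exists_isSectionOn
  choose! ψ hψ hbψ using fun X hX => (hb X hX).exists_isSectionOn
  -- Only subsets of `R` receive values in `R`; any other `Y` follows the section chosen for its
  -- copy.
  let φ : Finset ι → ι := fun Y => if Y ⊆ R then φ₀ Y else ψ (Y ∩ R) (Y \ R)
  have hφR : ∀ Y ⊆ R, φ Y = φ₀ Y := fun Y hY => if_pos hY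
  have hφ' : ∀ Y, ¬ Y ⊆ R → φ Y = ψ (Y ∩ R) (Y \ R) := fun Y hY => if_neg hY
  have hmem : ∀ Y, ¬ Y ⊆ R → φ Y ∈ Y \ R := by
    intro Y hY
    rw [hφ' Y hY]
    refine hψ _ Finset.inter_subset_right _ (fun a => by simp) ?_
    rwa [Finset.sdiff_nonempty]
  have hcopy : ∀ X ⊆ R, ∀ k ∉ R,
      (Finset.univ.filter fun Y => Y.Nonempty ∧ φ Y = k ∧ Y ∩ R = X).card = b X k := by
    intro X hX k hk
    rw [← hbψ X hX k (Finset.mem_compl.2 hk)]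
    refine Finset.card_bij' (fun Y _ => Y \ R) (fun Z _ => X ∪ Z) ?_ ?_ ?_ ?_
    · intro Y hY
      obtain ⟨hne, hYk, hYX⟩ := (Finset.mem_filter.1 hY).2
      have hYR : ¬ Y ⊆ R := by
        intro h
        rw [hφR Y h] at hYk
        exact hk (h (hYk ▸ hφ₀ Y h hne))
      rw [hφ' Y hYR, hYX] at hYk
      exact Finset.mem_filter.2 ⟨Finset.mem_powerset.2 fun a => by simp,
        Finset.sdiff_nonempty.2 hYR, hYk⟩
    · intro Z hZ
      obtain ⟨hZR, hne, hZk⟩ := Finset.mem_filter.1 hZ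
      have hZR := Finset.mem_powerset.1 hZR
      have h1 := union_inter_eq_of_subset hX hZR
      have h2 := union_sdiff_eq_of_subset hX hZR
      have h3 : ¬ X ∪ Z ⊆ R := by rwa [← Finset.sdiff_nonempty, h2]
      refine Finset.mem_filter.2 ⟨Finset.mem_univ _, hne.inr, ?_, h1⟩
      rw [hφ' _ h3, h1, h2, hZk]
    · intro Y hY
      obtain ⟨-, -, rfl⟩ := (Finset.mem_filter.1 hY).2
      rw [Finset.union_comm, Finset.sdiff_union_inter]
    · intro Z hZ
      have hZR := Finset.mem_powerset.1 (Finset.mem_filter.1 hZ).1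
      exact union_sdiff_eq_of_subset hX hZR
  refine ⟨φ, ?_, ?_, hcopy⟩
  · intro Y _ hne
    by_cases hY : Y ⊆ R
    · rw [hφR Y hY]
      exact hφ₀ Y hY hne
    · exact (Finset.mem_sdiff.1 (hmem Y hY)).1
  · intro k
    by_cases hk : k ∈ R
    · rw [← hS₀ k hk]
      congr 1
      ext Y
      simp only [Finset.mem_filter, Finset.mem_univ, true_and, Finset.mem_powerset]
      constructor
      · rintro ⟨hne, hYk⟩
        have hYR : Y ⊆ R := by
          by_contra h
          exact (Finset.mem_sdiff.1 (hmem Y h)).2 (hYk ▸ hk)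
        exact ⟨hYR, hne, hφR Y hYR ▸ hYk⟩
      · rintro ⟨hYR, hne, hYk⟩
        exact ⟨hne, (hφR Y hYR).trans hYk⟩
    · rw [← hbS k hk, ← card_filter_inter_eq φ R k]
      exact Finset.sum_congr rfl fun X hX => hcopy X (Finset.mem_powerset.1 hX) k hk

end

end CubeTree

/-! ### Changing the copy signatures -/

namespace CubeTree

section

variable {ι : Type*} [DecidableEq ι]

/-- Moving a unit from `j` to `i` can only break Hall's condition on a tight set that contains `j`
but not `i`. -/
theorem Feasible.of_shift {D : Finset ι} {a a' : ι → ℕ} (h : Feasible D a) {i j : ι}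
    (hi : i ∈ D) (hj : j ∈ D)
    (ha' : ∀ k, a' k + (if k = j then 1 else 0) = a k + (if k = i then 1 else 0))
    (hsep : ∀ L ⊆ D, ∑ k ∈ L, a k + 1 = 2 ^ L.card → j ∈ L → i ∈ L) : Feasible D a' := by
  have hsum : ∀ L : Finset ι,
      ∑ k ∈ L, a' k + (if j ∈ L then 1 else 0) = ∑ k ∈ L, a k + (if i ∈ L then 1 else 0) := by
    intro L
    have := Finset.sum_congr (rfl : L = L) fun k _ => ha' k
    simpa [Finset.sum_add_distrib] using this
  refine ⟨fun L hL => ?_, ?_⟩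
  · have h1 := hsum L
    have h2 := h.le L hL
    have h3 := hsep L hL
    by_cases hjL : j ∈ L <;> by_cases hiL : i ∈ L <;> simp only [hjL, hiL, if_true, if_false] at h1
    · omega
    · have : ∑ k ∈ L, a k + 1 ≠ 2 ^ L.card := fun h => hiL (h3 h hjL)
      omega
    · omega
    · omega
  · have h1 := hsum D
    have h2 := h.eq
    simp only [hi, hj, if_true] at h1
    omega

variable [Fintype ι]

/-- The nonempty subsets of a tight `R` already use up all the values in `R`. -/
theorem notMem_of_not_subset {φ : Finset ι → ι} (hφ : IsSectionOn Finset.univ φ) {R : Finset ι}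
    (hR : ∑ k ∈ R, (Finset.univ.filter fun Y => Y.Nonempty ∧ φ Y = k).card + 1 = 2 ^ R.card)
    {Y : Finset ι} (hY : ¬ Y ⊆ R) : φ Y ∉ R := by
  have hcard : (Finset.univ.filter fun Y => Y.Nonempty ∧ φ Y ∈ R).card =
      ∑ k ∈ R, (Finset.univ.filter fun Y => Y.Nonempty ∧ φ Y = k).card := by
    rw [Finset.card_eq_sum_card_fiberwise (f := φ) (t := R)]
    · refine Finset.sum_congr rfl fun k hk => ?_
      congr 1
      ext Z
      simp only [Finset.mem_filter, Finset.mem_univ, true_and]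
      constructor
      · rintro ⟨⟨h, -⟩, h'⟩
        exact ⟨h, h'⟩
      · rintro ⟨h, rfl⟩
        exact ⟨⟨h, hk⟩, rfl⟩
    · intro Z hZ
      exact (Finset.mem_filter.1 hZ).2.2
  have heq : R.powerset.filter Finset.Nonempty =
      Finset.univ.filter fun Y => Y.Nonempty ∧ φ Y ∈ R := by
    refine Finset.eq_of_subset_of_card_le ?_ ?_
    · intro Z hZ
      obtain ⟨hZR, hne⟩ := Finset.mem_filter.1 hZ
      exact Finset.mem_filter.2 ⟨Finset.mem_univ _, hne,
        Finset.mem_powerset.1 hZR (hφ Z (Finset.subset_univ _) hne)⟩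
    · have := card_nonempty_powerset_add_one R
      omega
  intro h
  have hne : Y.Nonempty := (Finset.sdiff_nonempty.2 hY).mono Finset.sdiff_subset
  have : Y ∈ R.powerset.filter Finset.Nonempty := by
    rw [heq]
    exact Finset.mem_filter.2 ⟨Finset.mem_univ _, hne, h⟩
  exact hY (Finset.mem_powerset.1 (Finset.mem_filter.1 this).1)

/-- For nonempty `Z ⊆ L ⊆ Rᶜ`, the value at `X ∪ Z` lies outside `R`, hence in `L`; this gives
Hall's condition. -/
theorem feasible_compl_of_isSectionOn {φ : Finset ι → ι} (hφ : IsSectionOn Finset.univ φ)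
    {R : Finset ι}
    (hR : ∑ k ∈ R, (Finset.univ.filter fun Y => Y.Nonempty ∧ φ Y = k).card + 1 = 2 ^ R.card)
    {X : Finset ι} (hX : X ⊆ R) :
    Feasible Rᶜ fun k =>
      (Finset.univ.filter fun Y => Y.Nonempty ∧ φ Y = k ∧ Y ∩ R = X).card := by
  have hsum : ∀ L : Finset ι,
      ∑ k ∈ L, (Finset.univ.filter fun Y => Y.Nonempty ∧ φ Y = k ∧ Y ∩ R = X).card =
        (Finset.univ.filter fun Y => Y.Nonempty ∧ φ Y ∈ L ∧ Y ∩ R = X).card := by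
    intro L
    rw [Finset.card_eq_sum_card_fiberwise (f := φ) (t := L)]
    · refine Finset.sum_congr rfl fun k hk => ?_
      congr 1
      ext Z
      simp only [Finset.mem_filter, Finset.mem_univ, true_and]
      constructor
      · rintro ⟨h, rfl, h'⟩
        exact ⟨⟨h, hk, h'⟩, rfl⟩
      · rintro ⟨⟨h, -, h'⟩, rfl⟩
        exact ⟨h, rfl, h'⟩
    · intro Z hZ
      exact (Finset.mem_filter.1 hZ).2.2.1
  have hle : ∀ L ⊆ Rᶜ, 2 ^ L.card ≤
      ∑ k ∈ L, (Finset.univ.filter fun Y => Y.Nonempty ∧ φ Y = k ∧ Y ∩ R = X).card + 1 := by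
    intro L hL
    rw [hsum, ← card_nonempty_powerset_add_one]
    refine Nat.add_le_add_right (Finset.card_le_card_of_injOn (fun Z => X ∪ Z) ?_ ?_) 1
    · intro Z hZ
      obtain ⟨hZL, hne⟩ := Finset.mem_filter.1 (Finset.mem_coe.1 hZ)
      have hZL := Finset.mem_powerset.1 hZL
      have hZR := hZL.trans hL
      have hnot : ¬ X ∪ Z ⊆ R := by
        rwa [← Finset.sdiff_nonempty, union_sdiff_eq_of_subset hX hZR]
      refine Finset.mem_coe.2 (Finset.mem_filter.2
        ⟨Finset.mem_univ _, hne.inr, ?_, union_inter_eq_of_subset hX hZR⟩)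
      rcases Finset.mem_union.1 (hφ (X ∪ Z) (Finset.subset_univ _) hne.inr) with h | h
      · exact absurd (hX h) (notMem_of_not_subset hφ hR hnot)
      · exact hZL h
    · intro Z hZ Z' hZ' h
      have hZ := Finset.mem_powerset.1 (Finset.mem_filter.1 (Finset.mem_coe.1 hZ)).1
      have hZ' := Finset.mem_powerset.1 (Finset.mem_filter.1 (Finset.mem_coe.1 hZ')).1
      rw [← union_sdiff_eq_of_subset hX (hZ.trans hL), show X ∪ Z = X ∪ Z' from h,
        union_sdiff_eq_of_subset hX (hZ'.trans hL)]
  refine ⟨hle, le_antisymm ?_ (hle _ subset_rfl)⟩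
  rw [hsum, ← card_nonempty_powerset_add_one]
  refine Nat.add_le_add_right (Finset.card_le_card_of_injOn (fun Y => Y \ R) ?_ ?_) 1
  · intro Y hY
    obtain ⟨-, hne, hY, -⟩ := Finset.mem_filter.1 (Finset.mem_coe.1 hY)
    refine Finset.mem_coe.2 (Finset.mem_filter.2
      ⟨Finset.mem_powerset.2 fun a => by simp, ?_⟩)
    exact ⟨φ Y, Finset.mem_sdiff.2 ⟨hφ Y (Finset.subset_univ _) hne, Finset.mem_compl.1 hY⟩⟩
  · intro Y hY Y' hY' h
    obtain ⟨-, -, -, hY⟩ := Finset.mem_filter.1 (Finset.mem_coe.1 hY)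
    obtain ⟨-, -, -, hY'⟩ := Finset.mem_filter.1 (Finset.mem_coe.1 hY')
    rw [← Finset.sdiff_union_inter Y R, ← Finset.sdiff_union_inter Y' R, hY, hY',
      show Y \ R = Y' \ R from h]

theorem exists_ne_of_feasible_family {S : ι → ℕ} {R : Finset ι}
    (hne : R.Nonempty) (hR : ∑ k ∈ R, S k + 1 = 2 ^ R.card) {i j : ι} (hij : i ≠ j)
    (hi : i ∉ R) (hj : j ∉ R)
    (hsep : ∀ L, R ⊆ L → ∑ k ∈ L, S k + 1 = 2 ^ L.card → (i ∈ L ↔ j ∈ L))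
    {b : Finset ι → ι → ℕ} (hb : ∀ X ⊆ R, Feasible Rᶜ (b X))
    (hbS : ∀ k ∉ R, ∑ X ∈ R.powerset, b X k = S k) :
    ∃ b' : Finset ι → ι → ℕ, (∀ X ⊆ R, Feasible Rᶜ (b' X)) ∧
      (∀ k ∉ R, ∑ X ∈ R.powerset, b' X k = S k) ∧ ∃ X ⊆ R, ∃ k ∉ R, b X k ≠ b' X k := by
  by_cases hcase : ∃ X ⊆ R, ∃ X' ⊆ R, ∃ k ∉ R, b X k ≠ b X' k
  · obtain ⟨X, hX, X', hX', k, hk, hne⟩ := hcase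
    have hswap : ∀ Z, Z ⊆ R ↔ Equiv.swap X X' Z ⊆ R := by
      intro Z
      rw [Equiv.swap_apply_def]
      split_ifs with h h
      · simp [h, hX, hX']
      · simp [h, hX, hX']
      · rfl
    refine ⟨fun Z => b (Equiv.swap X X' Z), fun Z hZ => hb _ ((hswap Z).1 hZ), ?_, X, hX, k, hk,
      ?_⟩
    · intro l hl
      rw [← hbS l hl]
      exact Finset.sum_equiv (Equiv.swap X X') (fun Z => by simp only [Finset.mem_powerset, ← hswap])
        fun Z _ => rfl
    · simpa only [Equiv.swap_apply_left] using hne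
  push Not at hcase
  set c := b ∅ with hc
  have hcb : ∀ X ⊆ R, ∀ k ∉ R, b X k = c k := fun X hX k hk =>
    hcase X hX ∅ (Finset.empty_subset _) k hk
  have hcS : ∀ k ∉ R, 2 ^ R.card * c k = S k := by
    intro k hk
    rw [← hbS k hk, Finset.sum_congr rfl fun X hX => hcb X (Finset.mem_powerset.1 hX) k hk]
    simp
  have hfc : Feasible Rᶜ c := hb ∅ (Finset.empty_subset _)
  -- Positivity keeps the subtractions in `c₁` and `c₂` from truncating.
  have hpos : ∀ k ∉ R, 1 ≤ c k := by
    intro k hk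
    have := hfc.le {k} (by simpa using hk)
    simp at this
    omega
  -- If `L` is tight for `c`, then `R ∪ L` is tight for `S`, since `S` is `2 ^ |R|` times `c`
  -- outside `R`.
  have hsep' : ∀ L ⊆ Rᶜ, ∑ k ∈ L, c k + 1 = 2 ^ L.card → (i ∈ L ↔ j ∈ L) := by
    intro L hL h
    have hdisj : Disjoint R L := Finset.subset_compl_iff_disjoint_left.1 hL
    have := hsep (R ∪ L) Finset.subset_union_left (by
      rw [Finset.sum_union hdisj, Finset.card_union_of_disjoint hdisj, pow_add, ← h,
        Finset.sum_congr rfl fun k hk => (hcS k (Finset.mem_compl.1 (hL hk))).symm,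
        ← Finset.mul_sum, ← hR]
      ring)
    simpa [hi, hj] using this
  let c₁ : ι → ℕ := fun k => if k = i then c k + 1 else if k = j then c k - 1 else c k
  let c₂ : ι → ℕ := fun k => if k = j then c k + 1 else if k = i then c k - 1 else c k
  have hci := hpos i hi
  have hcj := hpos j hj
  have h₁ : Feasible Rᶜ c₁ := by
    refine hfc.of_shift (i := i) (j := j) (by simpa using hi) (by simpa using hj) ?_
      fun L hL h => (hsep' L hL h).2
    intro k
    by_cases hki : k = i <;> by_cases hkj : k = j <;> grind
  have h₂ : Feasible Rᶜ c₂ := by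
    refine hfc.of_shift (i := j) (j := i) (by simpa using hj) (by simpa using hi) ?_
      fun L hL h => (hsep' L hL h).1
    intro k
    by_cases hki : k = i <;> by_cases hkj : k = j <;> grind
  have h₁₂ : ∀ k, c₁ k + c₂ k = 2 * c k := by
    intro k
    by_cases hki : k = i <;> by_cases hkj : k = j <;> grind
  obtain ⟨r, hr⟩ := hne
  -- Exactly half of the subsets of `R` contain `r`, so the two shifts cancel in the total.
  refine ⟨fun X => if r ∈ X then c₁ else c₂, ?_, ?_, ∅, Finset.empty_subset _, i, hi, ?_⟩
  · intro X _
    dsimp only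
    split_ifs
    · exact h₁
    · exact h₂
  · intro k hk
    have hR' : insert r (R.erase r) = R := Finset.insert_erase hr
    have hnot : r ∉ R.erase r := Finset.notMem_erase r R
    have hout : ∀ X ∈ (R.erase r).powerset, (if r ∈ X then c₁ else c₂) k = c₂ k := fun X hX => by
      rw [if_neg fun h => hnot (Finset.mem_powerset.1 hX h)]
    have hin : ∀ X ∈ (R.erase r).powerset, (if r ∈ insert r X then c₁ else c₂) k = c₁ k :=
      fun X _ => by rw [if_pos (Finset.mem_insert_self r X)]
    rw [← hcS k hk, ← hR', Finset.sum_powerset_insert hnot, Finset.card_insert_of_notMem hnot,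
      Finset.sum_congr rfl hout, Finset.sum_congr rfl hin]
    simp only [Finset.sum_const, Finset.card_powerset, smul_eq_mul]
    rw [← mul_add, add_comm (c₂ k), h₁₂, pow_succ]
    ring
  · simp only [Finset.notMem_empty, if_false, c₂, if_neg hij, if_true, ← hc]
    omega

theorem not_preconnected_of_tight {S : ι → ℕ} (hS : Feasible Finset.univ S) {R : Finset ι}
    (hne : R.Nonempty) (hR : ∑ k ∈ R, S k + 1 = 2 ^ R.card) {i j : ι} (hij : i ≠ j)
    (hi : i ∉ R) (hj : j ∉ R)
    (hsep : ∀ L, R ⊆ L → ∑ k ∈ L, S k + 1 = 2 ^ L.card → (i ∈ L ↔ j ∈ L)) :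
    ¬ (edgeSlideGraphSig S).Preconnected := by
  have : Nonempty ι := ⟨i⟩
  obtain ⟨φ, hφ, hφS⟩ := hS.exists_isSectionOn
  simp only [Finset.powerset_univ, Finset.mem_univ, true_imp_iff] at hφS
  have hRφ : ∑ k ∈ R, (Finset.univ.filter fun Y => Y.Nonempty ∧ φ Y = k).card + 1 =
      2 ^ R.card := by
    simpa only [hφS] using hR
  obtain ⟨b', hb', hbS', X, hX, k, hk, hX'⟩ := exists_ne_of_feasible_family hne hR hij hi hj hsep
    (fun X hX => feasible_compl_of_isSectionOn hφ hRφ hX)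
    (fun k _ => (card_filter_inter_eq φ R k).trans (hφS k))
  obtain ⟨φ', hφ', hφS', hφb⟩ :=
    exists_isSectionOn_univ ⟨fun L _ => hS.le L (Finset.subset_univ _), hR⟩ hb' hbS'
  intro hconn
  let T : treesWithSig S := ⟨⟨upright φ, isSpanningTree_upright hφ⟩,
    funext fun k => (sig_upright hφ k).trans (hφS k)⟩
  let T' : treesWithSig S := ⟨⟨upright φ', isSpanningTree_upright hφ'⟩,
    funext fun k => (sig_upright hφ' k).trans (hφS' k)⟩
  have h := ncard_copyEdges_eq_of_reachable (hconn T T') hR X hk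
  rw [ncard_copyEdges_upright hφ X hk, ncard_copyEdges_upright hφ' X hk, hφb X hX k hk] at h
  exact hX' h

/-- For incomparable sets `2 ^ |K| + 2 ^ |L| ≤ 2 ^ |K ∪ L|`, so Hall's condition on the union and
the intersection asks for more than `K` and `L` supply. -/
theorem subset_or_subset_of_tight {S : ι → ℕ} (hS : Feasible Finset.univ S) {K L : Finset ι}
    (hK : ∑ k ∈ K, S k + 1 = 2 ^ K.card) (hL : ∑ k ∈ L, S k + 1 = 2 ^ L.card) :
    K ⊆ L ∨ L ⊆ K := by
  by_contra! h
  have h1 := Finset.sum_union_inter (s₁ := K) (s₂ := L) (f := S)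
  have h2 := hS.le (K ∪ L) (Finset.subset_univ _)
  have h3 := hS.le (K ∩ L) (Finset.subset_univ _)
  have hKu : K.card < (K ∪ L).card := Finset.card_lt_card
    ⟨Finset.subset_union_left, fun h' => h.2 (Finset.subset_union_right.trans h')⟩
  have hLu : L.card < (K ∪ L).card := Finset.card_lt_card
    ⟨Finset.subset_union_right, fun h' => h.1 (Finset.subset_union_left.trans h')⟩
  have h4 : 2 ^ (K.card + 1) ≤ 2 ^ (K ∪ L).card := Nat.pow_le_pow_right two_pos hKu
  have h5 : 2 ^ (L.card + 1) ≤ 2 ^ (K ∪ L).card := Nat.pow_le_pow_right two_pos hLu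
  have h6 : 0 < 2 ^ (K ∩ L).card := by positivity
  rw [pow_succ] at h4 h5
  omega

end

/-! ### Excess and the choice of the tight set -/

theorem exists_tight_of_excess_eq_zero {n : ℕ} {S : Fin n → ℕ} {k : ℕ} (hk : k ≤ n)
    (h : excess S k = 0) : ∃ K : Finset (Fin n), K.card = k ∧ ∑ i ∈ K, S i + 1 = 2 ^ K.card := by
  have hne : {m : ℕ | ∃ K : Finset (Fin n), K.card = k ∧ ∑ i ∈ K, S i = m}.Nonempty := by
    obtain ⟨K, -, hK⟩ := Finset.exists_subset_card_eq
      (s := (Finset.univ : Finset (Fin n))) (n := k) (by simpa using hk)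
    exact ⟨_, K, hK, rfl⟩
  obtain ⟨K, hK, hsum⟩ := Nat.sInf_mem hne
  refine ⟨K, hK, ?_⟩
  rw [excess, ← hsum] at h
  rw [hK]
  zify
  push_cast at h
  linarith

theorem excess_eq_zero_of_tight {n : ℕ} {S : Fin n → ℕ} (hS : Feasible Finset.univ S)
    {K : Finset (Fin n)} (hK : ∑ i ∈ K, S i + 1 = 2 ^ K.card) : excess S K.card = 0 := by
  have : sInf {m : ℕ | ∃ L : Finset (Fin n), L.card = K.card ∧ ∑ i ∈ L, S i = m} =
      ∑ i ∈ K, S i := by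
    refine le_antisymm (Nat.sInf_le ⟨K, rfl, rfl⟩) (le_csInf ⟨_, K, rfl, rfl⟩ ?_)
    rintro _ ⟨L, hL, rfl⟩
    have := hS.le L (Finset.subset_univ _)
    rw [hL] at this
    omega
  rw [excess, this]
  zify at hK
  push_cast
  linarith

theorem card_unsatDirs_le {n : ℕ} (S : Fin n → ℕ) : (unsatDirs S).card ≤ unsatLength S := by
  rw [← Finset.card_range (unsatLength S)]
  refine Finset.card_le_card_of_injOn (fun i => ((Tuple.sort S).symm i : ℕ)) ?_ ?_
  · intro i hi
    simpa [unsatDirs] using hi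
  · intro i _ j _ h
    exact (Tuple.sort S).symm.injective (Fin.ext h)

theorem not_preconnected_of_isReducible_unsat {n : ℕ} {S : Fin n → ℕ}
    (hS : Feasible Finset.univ S) (hred : IsReducible (unsat S)) :
    ¬ (edgeSlideGraphSig S).Preconnected := by
  obtain ⟨R, hRne, hRuniv, hR⟩ := hred
  set s := unsatLength S with hs
  let R₀ : Finset (Fin n) := R.map (Function.Embedding.subtype _)
  have hR₀card : R₀.card = R.card := Finset.card_map _
  have hR₀ : ∑ i ∈ R₀, S i + 1 = 2 ^ R₀.card := by
    have h2 := Nat.one_le_two_pow (n := R.card)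
    rw [hR₀card, Finset.sum_map]
    simp only [unsat] at hR
    simp only [Function.Embedding.subtype_apply, hR]
    omega
  have hR₀lt : R₀.card < s := by
    rw [hR₀card]
    refine lt_of_lt_of_le (Finset.card_lt_univ_of_notMem (x := ?_) ?_)
      (le_of_eq_of_le (Fintype.card_coe _) (card_unsatDirs_le S))
    · exact (not_forall.1 (mt Finset.eq_univ_iff_forall.2 hRuniv)).choose
    · exact (not_forall.1 (mt Finset.eq_univ_iff_forall.2 hRuniv)).choose_spec
  have hR₀pos : 1 ≤ R₀.card := by
    rw [hR₀card]
    exact hRne.card_pos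
  have hn : 1 ≤ n := by
    have := Finset.card_le_univ R₀
    rw [Fintype.card_fin] at this
    omega
  have hmem : s ∈ {s : ℕ | 1 ≤ s ∧ s ≤ n ∧ ∀ k, s ≤ k → k ≤ n → excess S k = 0} := by
    refine Nat.sInf_mem ⟨n, hn, le_rfl, fun k hk hk' => ?_⟩
    obtain rfl := le_antisymm hk hk'
    simpa using excess_eq_zero_of_tight hS hS.eq
  obtain ⟨-, hsn, hexc⟩ := hmem
  -- A tight set of size `s - 1` would contradict the minimality of `s`; `R₀` ensures that `s - 1 ≥
  -- 1`.
  have hpred : ∀ K : Finset (Fin n), ∑ i ∈ K, S i + 1 = 2 ^ K.card → K.card ≠ s - 1 := by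
    intro K hK hKs
    have : s ≤ s - 1 := by
      refine Nat.sInf_le ⟨by omega, by omega, fun k hk hkn => ?_⟩
      rcases eq_or_lt_of_le hk with rfl | hk
      · rw [← hKs]
        exact excess_eq_zero_of_tight hS hK
      · exact hexc k (by omega) hkn
    omega
  obtain ⟨K, hKs, hK⟩ := exists_tight_of_excess_eq_zero hsn (hexc s le_rfl hsn)
  let F : Finset (Finset (Fin n)) :=
    Finset.univ.filter fun L => ∑ i ∈ L, S i + 1 = 2 ^ L.card ∧ L.card < s
  have hF : ∀ L, L ∈ F ↔ ∑ i ∈ L, S i + 1 = 2 ^ L.card ∧ L.card < s := by simp [F]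
  obtain ⟨M, hMF, hmax⟩ := F.exists_max_image Finset.card ⟨R₀, (hF _).2 ⟨hR₀, hR₀lt⟩⟩
  obtain ⟨hM, hMs⟩ := (hF _).1 hMF
  have hMpos : 1 ≤ M.card := hR₀pos.trans (hmax R₀ ((hF _).2 ⟨hR₀, hR₀lt⟩))
  have hMK : M ⊆ K := by
    rcases subset_or_subset_of_tight hS hM hK with h | h
    · exact h
    · have := Finset.card_le_card h
      omega
  have hcard : 1 < (K \ M).card := by
    have := hpred M hM
    have := Finset.card_sdiff_add_card_eq_card hMK
    omega
  obtain ⟨i, hi, j, hj, hij⟩ := Finset.one_lt_card.1 hcard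
  obtain ⟨hiK, hiM⟩ := Finset.mem_sdiff.1 hi
  obtain ⟨hjK, hjM⟩ := Finset.mem_sdiff.1 hj
  refine not_preconnected_of_tight hS (Finset.card_pos.1 hMpos) hM hij hiM hjM fun L hML hL => ?_
  -- In the chain, a tight set containing `M` either contains `K` or equals `M`.
  rcases subset_or_subset_of_tight hS hK hL with h | h
  · exact ⟨fun _ => h hjK, fun _ => h hiK⟩
  · rcases lt_or_ge L.card s with hLs | hLs
    · have := Finset.eq_of_subset_of_card_le hML (hmax L ((hF _).2 ⟨hL, hLs⟩))
      rw [← this]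
      exact ⟨fun h => absurd h hiM, fun h => absurd h hjM⟩
    · rw [Finset.eq_of_subset_of_card_le h (hKs.trans_le hLs)]
      exact ⟨fun _ => hjK, fun _ => hiK⟩

theorem IsSignature.feasible {ι : Type*} [DecidableEq ι] [Fintype ι] {S : ι → ℕ}
    (hS : IsSignature S) : Feasible Finset.univ S := by
  obtain ⟨T, hT, rfl⟩ := hS
  exact ⟨fun L _ => two_pow_card_le_sum_sig_add_one hT L, sum_sig_add_one hT⟩

end CubeTree

/-- If `S` is a strictly reducible signature of the `n`-cube, then its edge slide graph `E(S)` is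
disconnected: it has two vertices that are not joined by a walk. -/
theorem theorem7p1 {n : ℕ} (S : Fin n → ℕ) (hS : CubeTree.IsSignature S)
    (hred : CubeTree.IsStrictlyReducible S) :
    ¬ (CubeTree.edgeSlideGraphSig S).Preconnected := by
  refine CubeTree.not_preconnected_of_isReducible_unsat hS.feasible ?_
  by_contra h
  exact hred.2 ⟨hred.1, h⟩
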